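/- Let $\ell_p=\ell_p(\mathbb N)$ over the scalar field $\mathbb{R}$ or $\mathbb{C}$, let $(\delta_k)$ be the standard basis of $\ell_2$, and for a bounded operator $A:\ell_2\to\ell_2$ put $\|A\|_{1,1}=\sum_{k,l}|\langle A\delta_k,\delta_l\rangle|\in[0,\infty]$. Let $\Gamma$ be the set of self-adjoint positive-semidefinite bounded operators $A$ on $\ell_2$ with $\|A\|_{1,1}<\infty$. For $A\in\Gamma$ let $\Psi_A:c_0\to\ell_1$ be the bounded operator $\Psi_A b=\sum_k b(k)A\delta_k$, and set $$\gamma_+(A)=\inf\Big\{\sum_{k=1}^\infty\|x_k\|_1^2 \;:\; x_k\in\ell_1,\ \Psi_A=\sum_{k=1}^\infty x_kx_k^*\ \text{in the strong operator topology}\Big\},\qquad \inf\emptyset=\infty,$$ where $(x x^*)b=\big(\sum_j b(j)\overline{x(j)}\big)x$. Let $\Gamma_+=\{A\in\Gamma:\gamma_+(A)<\infty\}$. **Theorem.** If $A\in\Gamma_+$ and $p$ is a univariate real polynomial with nonnegative coefficients and $p(0)=0$, then $p(A)\in\Gamma_+$. Moreover, $A^2\in\Gamma_+$ for every $A\in\Gamma$.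 -/

import Mathlib

open scoped ENNReal ZeroAtInfty

namespace Feichtinger

/-- The sequence space `ℓ_p = ℓ_p(ℕ)` over the scalar field `𝕜` (real or complex). -/
abbrev ell (𝕜 : Type*) [RCLike 𝕜] (p : ℝ≥0∞) : Type _ := lp (fun _ : ℕ => 𝕜) p

/-- The space `c₀` of sequences converging to zero, with the supremum norm
(continuous functions on the discrete space `ℕ` that vanish at infinity). -/
abbrev cZero (𝕜 : Type*) [RCLike 𝕜] : Type _ := C₀(ℕ, 𝕜)

/-- The standard basis vector `δ_k` of `ℓ₂`. -/
noncomputable def delta (𝕜 : Type*) [RCLike 𝕜] (k : ℕ) : ell 𝕜 2 :=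
  lp.single 2 k (1 : 𝕜)

/-- The entrywise norm `‖A‖_{1,1} = ∑_k ∑_l |⟨A δ_k, δ_l⟩| ∈ [0, ∞]`. -/
noncomputable def entryNorm {𝕜 : Type*} [RCLike 𝕜] (A : ell 𝕜 2 →L[𝕜] ell 𝕜 2) : ℝ≥0∞ :=
  ∑' k : ℕ, ∑' l : ℕ, ‖inner 𝕜 (A (delta 𝕜 k)) (delta 𝕜 l)‖ₑ

theorem enorm_inner_delta {𝕜 : Type*} [RCLike 𝕜] (v : ell 𝕜 2) (l : ℕ) :
    ‖inner 𝕜 v (delta 𝕜 l)‖ₑ = ‖v l‖ₑ := by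
  have h : ‖inner 𝕜 v (delta 𝕜 l)‖ = ‖v l‖ := by
    rw [delta, lp.inner_single_right]
    simp
  rw [← ofReal_norm, ← ofReal_norm, h]

theorem tsum_enorm_col_ne_top {𝕜 : Type*} [RCLike 𝕜] {A : ell 𝕜 2 →L[𝕜] ell 𝕜 2}
    (hA : entryNorm A < ∞) (k : ℕ) : ∑' l : ℕ, ‖A (delta 𝕜 k) l‖ₑ ≠ ∞ := by
  have h := ENNReal.ne_top_of_tsum_ne_top hA.ne k
  simpa only [enorm_inner_delta] using h

theorem memlp_col {𝕜 : Type*} [RCLike 𝕜] {A : ell 𝕜 2 →L[𝕜] ell 𝕜 2}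
    (hA : entryNorm A < ∞) (k : ℕ) :
    Memℓp (fun l : ℕ => A (delta 𝕜 k) l) 1 := by
  have h := ENNReal.summable_toReal (tsum_enorm_col_ne_top hA k)
  exact memℓp_gen (by simpa using h)

/-- The column `A δ_k`, as an element of `ℓ₁` (for an operator with `‖A‖_{1,1} < ∞`). -/
noncomputable def col {𝕜 : Type*} [RCLike 𝕜] (A : ell 𝕜 2 →L[𝕜] ell 𝕜 2)
    (hA : entryNorm A < ∞) (k : ℕ) : ell 𝕜 1 :=
  ⟨fun l : ℕ => A (delta 𝕜 k) l, memlp_col hA k⟩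

theorem enorm_col {𝕜 : Type*} [RCLike 𝕜] (A : ell 𝕜 2 →L[𝕜] ell 𝕜 2)
    (hA : entryNorm A < ∞) (k : ℕ) :
    ‖col A hA k‖ₑ = ∑' l : ℕ, ‖inner 𝕜 (A (delta 𝕜 k)) (delta 𝕜 l)‖ₑ := by
  have h := tsum_enorm_col_ne_top hA k
  have h1 : ‖col A hA k‖ = (∑' l : ℕ, ‖A (delta 𝕜 k) l‖ₑ).toReal := by
    rw [lp.norm_eq_tsum_rpow (by norm_num), ENNReal.tsum_toReal_eq (ENNReal.ne_top_of_tsum_ne_top h)]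
    simp [col]
  simp only [enorm_inner_delta]
  rw [← ofReal_norm, h1, ENNReal.ofReal_toReal h]

theorem summable_norm_col {𝕜 : Type*} [RCLike 𝕜] (A : ell 𝕜 2 →L[𝕜] ell 𝕜 2)
    (hA : entryNorm A < ∞) : Summable fun k : ℕ => ‖col A hA k‖ := by
  have h : ∑' k : ℕ, ‖col A hA k‖ₑ ≠ ∞ := by
    simp only [enorm_col]
    exact hA.ne
  simpa using ENNReal.summable_toReal h

theorem norm_apply_le {𝕜 : Type*} [RCLike 𝕜] (b : cZero 𝕜) (k : ℕ) : ‖b k‖ ≤ ‖b‖ := by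
  rw [← ZeroAtInftyContinuousMap.norm_toBCF_eq_norm]
  exact b.toBCF.norm_coe_le_norm k

theorem summable_norm_action {𝕜 : Type*} [RCLike 𝕜] (A : ell 𝕜 2 →L[𝕜] ell 𝕜 2)
    (hA : entryNorm A < ∞) (b : cZero 𝕜) : Summable fun k : ℕ => ‖b k • col A hA k‖ := by
  refine Summable.of_nonneg_of_le (fun _ => norm_nonneg _) (fun k => ?_)
    ((summable_norm_col A hA).mul_left ‖b‖)
  rw [norm_smul]
  exact mul_le_mul_of_nonneg_right (norm_apply_le b k) (norm_nonneg _)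

/-- The induced action `Ψ_A : c₀ → ℓ₁`, `b ↦ ∑_k b(k) A δ_k` (the series converges absolutely
in `ℓ₁`), of an operator `A` on `ℓ₂` with `‖A‖_{1,1} < ∞`; it is a bounded operator. -/
noncomputable def inducedAction {𝕜 : Type*} [RCLike 𝕜] (A : ell 𝕜 2 →L[𝕜] ell 𝕜 2)
    (hA : entryNorm A < ∞) : cZero 𝕜 →L[𝕜] ell 𝕜 1 :=
  LinearMap.mkContinuous
    { toFun := fun b => ∑' k : ℕ, b k • col A hA k
      map_add' := fun b c => by
        rw [← (summable_norm_action A hA b).of_norm.tsum_add (summable_norm_action A hA c).of_norm]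
        simp [add_smul]
      map_smul' := fun r b => by
        rw [RingHom.id_apply, ← (summable_norm_action A hA b).of_norm.tsum_const_smul]
        simp [mul_smul] }
    (∑' k : ℕ, ‖col A hA k‖)
    (fun b => by
      refine (norm_tsum_le_tsum_norm (summable_norm_action A hA b)).trans ?_
      rw [mul_comm, ← tsum_mul_left]
      refine (summable_norm_action A hA b).tsum_le_tsum (fun k => ?_)
        ((summable_norm_col A hA).mul_left ‖b‖)
      rw [norm_smul]
      exact mul_le_mul_of_nonneg_right (norm_apply_le b k) (norm_nonneg _))

theorem inducedAction_apply {𝕜 : Type*} [RCLike 𝕜] (A : ell 𝕜 2 →L[𝕜] ell 𝕜 2)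
    (hA : entryNorm A < ∞) (b : cZero 𝕜) :
    inducedAction A hA b = ∑' k : ℕ, b k • col A hA k := rfl

/-- The rank-one operator `x x^*` of `x ∈ ℓ₁`, applied to `b ∈ c₀`:
`(x x^*) b = (∑_j b(j) conj(x(j))) x ∈ ℓ₁`. -/
noncomputable def rankOne {𝕜 : Type*} [RCLike 𝕜] (x : ell 𝕜 1) (b : cZero 𝕜) : ell 𝕜 1 :=
  (∑' j : ℕ, b j * starRingEnd 𝕜 (x j)) • x

/-- The series defining `rankOne` converges absolutely. -/
theorem summable_rankOne {𝕜 : Type*} [RCLike 𝕜] (x : ell 𝕜 1) (b : cZero 𝕜) :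
    Summable fun j : ℕ => ‖b j * starRingEnd 𝕜 (x j)‖ := by
  have hx : Summable fun j : ℕ => ‖x j‖ := by
    simpa using (lp.memℓp x).summable (by norm_num)
  refine Summable.of_nonneg_of_le (fun _ => norm_nonneg _) (fun j => ?_) (hx.mul_left ‖b‖)
  rw [norm_mul, RCLike.norm_conj]
  exact mul_le_mul_of_nonneg_right (norm_apply_le b j) (norm_nonneg _)

/-- The class `Γ` of self-adjoint positive-semidefinite bounded operators on `ℓ₂`
with `‖A‖_{1,1} < ∞` (self-adjointness is part of `ContinuousLinearMap.IsPositive`). -/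
def Gam (𝕜 : Type*) [RCLike 𝕜] : Set (ell 𝕜 2 →L[𝕜] ell 𝕜 2) :=
  {A | A.IsPositive ∧ entryNorm A < ∞}

/-- `Ψ_A = ∑_k x_k x_k^*` in the strong operator topology of bounded operators `c₀ → ℓ₁`. -/
def IsDecomposition {𝕜 : Type*} [RCLike 𝕜] (A : ell 𝕜 2 →L[𝕜] ell 𝕜 2)
    (hA : entryNorm A < ∞) (x : ℕ → ell 𝕜 1) : Prop :=
  ∀ b : cZero 𝕜, Filter.Tendsto (fun N : ℕ => ∑ k ∈ Finset.range N, rankOne (x k) b)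
    Filter.atTop (nhds (inducedAction A hA b))

/-- `γ₊(A) = inf { ∑_k ‖x_k‖₁² : Ψ_A = ∑_k x_k x_k^* strongly } ∈ [0, ∞]`, for `A ∈ Γ`;
the infimum of the empty set is `∞`. -/
noncomputable def gammaPlus {𝕜 : Type*} [RCLike 𝕜] (A : ell 𝕜 2 →L[𝕜] ell 𝕜 2)
    (hA : A ∈ Gam 𝕜) : ℝ≥0∞ :=
  ⨅ (x : ℕ → ell 𝕜 1) (_ : IsDecomposition A hA.2 x), ∑' k : ℕ, ‖x k‖ₑ ^ 2

/-- The class `Γ₊ = {A ∈ Γ : γ₊(A) < ∞}`. -/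
def GamPlus (𝕜 : Type*) [RCLike 𝕜] : Set (ell 𝕜 2 →L[𝕜] ell 𝕜 2) :=
  {A | ∃ hA : A ∈ Gam 𝕜, gammaPlus A hA < ∞}

end Feichtinger

namespace Feichtinger

variable {𝕜 : Type*} [RCLike 𝕜]

/-! Membership in Γ₊ amounts to a representation A = ∑ u_k u_k^* on ℓ₂ with ∑ ‖u_k‖₁² < ∞
(`mem_gamPlus_iff`); such series converge absolutely in operator norm. These operators form a convex
cone. For B ∈ Γ, B(uu^*)B = (Bu)(Bu)^* and ‖Bu‖₁ ≤ ‖B‖_{1,1} ‖u‖₁, so A ↦ BAB preserves the cone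
(`IsL1Rep.conj`). Also A² = ∑ (Aδ_k)(Aδ_k)^* with ∑ ‖Aδ_k‖₁² ≤ ‖A‖_{1,1}² (`IsL1Rep.sq`). From A and
A², the recursion A^{n+2} = A·Aⁿ·A reaches every positive power. -/

/-- The `ℓ₁` norm of a vector of `ℓ₂`, possibly infinite. -/
noncomputable def l1Norm (u : ell 𝕜 2) : ℝ≥0∞ := ∑' i : ℕ, ‖u i‖ₑ

/-! ### Coordinates and ℓ₁ bounds -/

theorem hasSum_smul_delta (u : ell 𝕜 2) : HasSum (fun j : ℕ => u j • delta 𝕜 j) u := by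
  have h := lp.hasSum_single (p := 2) (by norm_num) u
  refine h.congr_fun fun j => ?_
  rw [delta, ← lp.single_smul, smul_eq_mul, mul_one]

theorem enorm_delta (j : ℕ) : ‖delta 𝕜 j‖ₑ = 1 := by
  rw [← ofReal_norm, delta, lp.norm_single (by norm_num)]
  simp

theorem inner_delta_left (i : ℕ) (v : ell 𝕜 2) : inner 𝕜 (delta 𝕜 i) v = v i := by
  rw [delta, lp.inner_single_left]
  simp

theorem inner_delta_right (i : ℕ) (v : ell 𝕜 2) :
    inner 𝕜 v (delta 𝕜 i) = starRingEnd 𝕜 (v i) := by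
  rw [← inner_conj_symm, inner_delta_left]

theorem enorm_le_l1Norm (u : ell 𝕜 2) : ‖u‖ₑ ≤ l1Norm u := by
  rw [← (hasSum_smul_delta u).tsum_eq]
  refine enorm_tsum_le_tsum_enorm.trans (le_of_eq ?_)
  rw [(hasSum_smul_delta u).tsum_eq]
  exact tsum_congr fun j => by rw [enorm_smul, enorm_delta, mul_one]

theorem entryNorm_eq_tsum_l1Norm (A : ell 𝕜 2 →L[𝕜] ell 𝕜 2) :
    entryNorm A = ∑' k : ℕ, l1Norm (A (delta 𝕜 k)) := by
  simp only [entryNorm, l1Norm, enorm_inner_delta]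

theorem hasSum_apply_delta (B : ell 𝕜 2 →L[𝕜] ell 𝕜 2) (u : ell 𝕜 2) (i : ℕ) :
    HasSum (fun j : ℕ => u j * B (delta 𝕜 j) i) (B u i) := by
  have h := ((hasSum_smul_delta u).mapL B).mapL (lp.evalCLM 𝕜 (fun _ : ℕ => 𝕜) 2 i)
  simp only [map_smul, smul_eq_mul] at h
  exact h

/-- Expand B u along the columns of B and bound each column's ℓ₁ norm by the sum of all of them. -/
theorem l1Norm_apply_le (B : ell 𝕜 2 →L[𝕜] ell 𝕜 2) (u : ell 𝕜 2) :
    l1Norm (B u) ≤ l1Norm u * entryNorm B := by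
  rw [entryNorm_eq_tsum_l1Norm]
  calc l1Norm (B u) ≤ ∑' i : ℕ, ∑' j : ℕ, ‖u j‖ₑ * ‖B (delta 𝕜 j) i‖ₑ := by
        refine ENNReal.tsum_le_tsum fun i => ?_
        rw [← (hasSum_apply_delta B u i).tsum_eq]
        refine enorm_tsum_le_tsum_enorm.trans (le_of_eq ?_)
        simp only [enorm_mul]
    _ = ∑' j : ℕ, ‖u j‖ₑ * l1Norm (B (delta 𝕜 j)) := by
        rw [ENNReal.tsum_comm]
        simp only [ENNReal.tsum_mul_left, l1Norm]
    _ ≤ ∑' j : ℕ, ‖u j‖ₑ * ∑' k : ℕ, l1Norm (B (delta 𝕜 k)) :=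
        ENNReal.tsum_le_tsum fun j => mul_le_mul_right (ENNReal.le_tsum j) _
    _ = _ := by rw [ENNReal.tsum_mul_right, l1Norm]

theorem enorm_ell_one (x : ell 𝕜 1) : ‖x‖ₑ = ∑' i : ℕ, ‖x i‖ₑ := by
  have hs : Summable fun i : ℕ => ‖x i‖ := by
    simpa using (lp.memℓp x).summable (by norm_num)
  rw [← ofReal_norm, lp.norm_eq_tsum_rpow (by norm_num)]
  simp only [ENNReal.toReal_one, Real.rpow_one, div_one]
  rw [ENNReal.ofReal_tsum_of_nonneg (fun _ => norm_nonneg _) hs]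
  simp only [ofReal_norm]

theorem tsum_enorm_mul_le (b : cZero 𝕜) (x : ell 𝕜 1) :
    ∑' j : ℕ, ‖b j‖ₑ * ‖x j‖ₑ ≤ ‖b‖ₑ * ‖x‖ₑ := by
  rw [enorm_ell_one, ← ENNReal.tsum_mul_left]
  exact ENNReal.tsum_le_tsum fun j =>
    mul_le_mul_left (enorm_le_iff_norm_le.2 (norm_apply_le b j)) _

theorem enorm_rankOne_le (x : ell 𝕜 1) (b : cZero 𝕜) : ‖rankOne x b‖ₑ ≤ ‖b‖ₑ * ‖x‖ₑ ^ 2 := by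
  rw [rankOne, enorm_smul, sq, ← mul_assoc]
  refine mul_le_mul_left (enorm_tsum_le_tsum_enorm.trans ?_) _
  simpa only [enorm_mul, RCLike.enorm_conj] using tsum_enorm_mul_le b x

theorem summable_of_tsum_enorm_ne_top {ι E : Type*} [NormedAddCommGroup E] [CompleteSpace E]
    {f : ι → E} (h : ∑' i, ‖f i‖ₑ ≠ ∞) : Summable f :=
  (tsum_enorm_ne_top_iff_summable_norm.1 h).of_norm

theorem tsum_sq_le_sq_tsum (f : ℕ → ℝ≥0∞) : ∑' k, f k ^ 2 ≤ (∑' k, f k) ^ 2 := by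
  rw [sq, ← ENNReal.tsum_mul_right]
  refine ENNReal.tsum_le_tsum fun k => ?_
  rw [sq]
  exact mul_le_mul_right (ENNReal.le_tsum k) _

/-! ### Rank-one representations on ℓ₂ -/

/-- `A = ∑_k u_k u_k^*` in operator norm on `ℓ₂`, with `∑_k ‖u_k‖₁² < ∞`. -/
structure IsL1Rep (A : ell 𝕜 2 →L[𝕜] ell 𝕜 2) (u : ℕ → ell 𝕜 2) : Prop where
  tsum_ne_top : ∑' k : ℕ, l1Norm (u k) ^ 2 ≠ ∞
  hasSum : HasSum (fun k : ℕ => InnerProductSpace.rankOne 𝕜 (u k) (u k)) A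

theorem summable_rankOne_of_l1Norm {u : ℕ → ell 𝕜 2} (hu : ∑' k : ℕ, l1Norm (u k) ^ 2 ≠ ∞) :
    Summable fun k : ℕ => InnerProductSpace.rankOne 𝕜 (u k) (u k) := by
  refine summable_of_tsum_enorm_ne_top (ne_top_of_le_ne_top hu (ENNReal.tsum_le_tsum fun k => ?_))
  rw [InnerProductSpace.enorm_rankOne, sq]
  exact mul_le_mul' (enorm_le_l1Norm _) (enorm_le_l1Norm _)

theorem hasSum_rankOne_entry {u : ℕ → ell 𝕜 2} {A : ell 𝕜 2 →L[𝕜] ell 𝕜 2}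
    (h : HasSum (fun k : ℕ => InnerProductSpace.rankOne 𝕜 (u k) (u k)) A) (i j : ℕ) :
    HasSum (fun k : ℕ => starRingEnd 𝕜 (u k j) * u k i) (A (delta 𝕜 j) i) := by
  have h1 := (h.mapL (ContinuousLinearMap.apply 𝕜 (ell 𝕜 2) (delta 𝕜 j))).mapL
    (lp.evalCLM 𝕜 (fun _ : ℕ => 𝕜) 2 i)
  simp only [ContinuousLinearMap.apply_apply, InnerProductSpace.rankOne_apply, map_smul,
    inner_delta_right, smul_eq_mul] at h1
  exact h1

theorem ext_entry {A B : ell 𝕜 2 →L[𝕜] ell 𝕜 2}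
    (h : ∀ i j : ℕ, A (delta 𝕜 j) i = B (delta 𝕜 j) i) : A = B := by
  ext u i
  refine (hasSum_apply_delta A u i).unique ?_
  simpa only [h] using hasSum_apply_delta B u i

/-- The ℓ₁ bound alone forces norm convergence, so only the limit has to be identified, and matrix
entries determine it. -/
theorem isL1Rep_of_entry {u : ℕ → ell 𝕜 2} {A : ell 𝕜 2 →L[𝕜] ell 𝕜 2}
    (hu : ∑' k : ℕ, l1Norm (u k) ^ 2 ≠ ∞)
    (h : ∀ i j : ℕ, HasSum (fun k : ℕ => starRingEnd 𝕜 (u k j) * u k i) (A (delta 𝕜 j) i)) :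
    IsL1Rep A u := by
  have hs := (summable_rankOne_of_l1Norm hu).hasSum
  have hA : A = ∑' k : ℕ, InnerProductSpace.rankOne 𝕜 (u k) (u k) :=
    ext_entry fun i j => (h i j).unique (hasSum_rankOne_entry hs i j)
  exact ⟨hu, hA ▸ hs⟩

namespace IsL1Rep

variable {A B : ell 𝕜 2 →L[𝕜] ell 𝕜 2} {u v : ℕ → ell 𝕜 2}

theorem isPositive (h : IsL1Rep A u) : A.IsPositive := by
  have key : ∀ x y : ell 𝕜 2,
      HasSum (fun k => inner 𝕜 x (u k) * inner 𝕜 (u k) y) (inner 𝕜 (A x) y) := fun x y => by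
    have h1 := (h.hasSum.mapL (ContinuousLinearMap.apply 𝕜 (ell 𝕜 2) x))
    have h2 := (h1.map (innerSLFlip 𝕜 y : ell 𝕜 2 →L⋆[𝕜] 𝕜) (innerSLFlip 𝕜 y).continuous)
    simpa [Function.comp_def, inner_smul_left] using h2
  rw [ContinuousLinearMap.isPositive_def]
  refine ⟨fun x y => ?_, fun x => ?_⟩
  · have h1 := (key y x).map (starRingEnd 𝕜) RCLike.continuous_conj
    simp only [Function.comp_def, map_mul, inner_conj_symm] at h1
    refine (key x y).unique (h1.congr_fun fun k => mul_comm _ _)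
  · have h1 := (key x x).mapL (RCLike.reCLM : 𝕜 →L[ℝ] ℝ)
    refine h1.nonneg fun k => ?_
    rw [RCLike.reCLM_apply, inner_mul_symm_re_eq_norm]
    exact norm_nonneg _

theorem entryNorm_le (h : IsL1Rep A u) : entryNorm A ≤ ∑' k : ℕ, l1Norm (u k) ^ 2 := by
  simp only [entryNorm_eq_tsum_l1Norm, l1Norm]
  calc ∑' j : ℕ, ∑' i : ℕ, ‖A (delta 𝕜 j) i‖ₑ
      ≤ ∑' j : ℕ, ∑' i : ℕ, ∑' k : ℕ, ‖u k j‖ₑ * ‖u k i‖ₑ := by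
        refine ENNReal.tsum_le_tsum fun j => ENNReal.tsum_le_tsum fun i => ?_
        rw [← (hasSum_rankOne_entry h.hasSum i j).tsum_eq]
        refine enorm_tsum_le_tsum_enorm.trans (le_of_eq ?_)
        simp only [enorm_mul, RCLike.enorm_conj]
    _ = ∑' k : ℕ, ∑' j : ℕ, ∑' i : ℕ, ‖u k j‖ₑ * ‖u k i‖ₑ := by
        rw [ENNReal.tsum_comm (f := fun k j => ∑' i : ℕ, ‖u k j‖ₑ * ‖u k i‖ₑ)]
        exact tsum_congr fun j => ENNReal.tsum_comm
    _ = ∑' k : ℕ, (∑' i : ℕ, ‖u k i‖ₑ) ^ 2 := by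
        simp only [ENNReal.tsum_mul_left, ENNReal.tsum_mul_right, sq]

theorem mem_gam (h : IsL1Rep A u) : A ∈ Gam 𝕜 :=
  ⟨h.isPositive, h.entryNorm_le.trans_lt h.tsum_ne_top.lt_top⟩

theorem add (hA : IsL1Rep A u) (hB : IsL1Rep B v) : ∃ w, IsL1Rep (A + B) w := by
  -- Interleave the two sequences.
  let w : ℕ → ell 𝕜 2 := fun n => if Even n then u (n / 2) else v (n / 2)
  have h0 : ∀ k, w (2 * k) = u k := fun k => by simp [w]
  have h1 : ∀ k, w (2 * k + 1) = v k := fun k => by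
    have : (2 * k + 1) / 2 = k := by omega
    simp [w, this]
  refine ⟨w, ?_, HasSum.even_add_odd ?_ ?_⟩
  · rw [← tsum_even_add_odd ENNReal.summable ENNReal.summable]
    simp only [h0, h1]
    exact ENNReal.add_ne_top.2 ⟨hA.tsum_ne_top, hB.tsum_ne_top⟩
  · simpa only [h0] using hA.hasSum
  · simpa only [h1] using hB.hasSum

theorem smul (hA : IsL1Rep A u) {c : ℝ} (hc : 0 ≤ c) :
    IsL1Rep ((c : 𝕜) • A) fun k => ((√c : ℝ) : 𝕜) • u k := by
  refine ⟨?_, ?_⟩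
  · simp only [l1Norm, lp.coeFn_smul, Pi.smul_apply, enorm_smul, ENNReal.tsum_mul_left, mul_pow]
    exact ENNReal.mul_ne_top (by simp) hA.tsum_ne_top
  · refine (hA.hasSum.const_smul (c : 𝕜)).congr_fun fun k => ?_
    ext1 x
    simp only [InnerProductSpace.rankOne_apply, smul_apply, inner_smul_left,
      RCLike.conj_ofReal, smul_smul]
    congr 1
    rw [mul_right_comm, ← RCLike.ofReal_mul, Real.mul_self_sqrt hc]

theorem zero : IsL1Rep (0 : ell 𝕜 2 →L[𝕜] ell 𝕜 2) 0 := by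
  refine ⟨by simp [l1Norm], ?_⟩
  simp

theorem conj (hA : IsL1Rep A u) (hB : B ∈ Gam 𝕜) : IsL1Rep (B * A * B) fun k => B (u k) := by
  refine ⟨?_, ?_⟩
  · refine ne_top_of_le_ne_top (b := (∑' k : ℕ, l1Norm (u k) ^ 2) * entryNorm B ^ 2)
      (ENNReal.mul_ne_top hA.tsum_ne_top (ENNReal.pow_ne_top hB.2.ne)) ?_
    rw [← ENNReal.tsum_mul_right]
    refine ENNReal.tsum_le_tsum fun k => ?_
    rw [← mul_pow]
    exact pow_le_pow_left' (l1Norm_apply_le B (u k)) 2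
  · refine ((hA.hasSum.mul_left B).mul_right B).congr_fun fun k => ?_
    ext1 x
    simp [hB.1.inner_left_eq_inner_right]

theorem sq (hA : A ∈ Gam 𝕜) : IsL1Rep (A ^ 2) fun k => A (delta 𝕜 k) := by
  refine isL1Rep_of_entry ?_ fun i j => ?_
  · refine ne_top_of_le_ne_top ?_ (tsum_sq_le_sq_tsum _)
    rw [← entryNorm_eq_tsum_l1Norm]
    exact ENNReal.pow_ne_top hA.2.ne
  · have h := hasSum_apply_delta A (A (delta 𝕜 j)) i
    rw [_root_.sq]
    refine h.congr_fun fun k => ?_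
    rw [← inner_delta_right, hA.1.inner_left_eq_inner_right, inner_delta_left]

/-- Compare i-th coordinates: both sides are iterated sums of b(j) conj(x_k(j)) x_k(i), a double
series dominated by ‖b‖ ∑ ‖x_k‖₁², so Fubini applies. -/
theorem isDecomposition (h : IsL1Rep A u) (hA : entryNorm A < ∞) {x : ℕ → ell 𝕜 1}
    (hx : ∀ k i, x k i = u k i) : IsDecomposition A hA x := by
  intro b
  have hu : ∀ k, l1Norm (u k) = ‖x k‖ₑ := fun k => by simp only [enorm_ell_one, l1Norm, hx]
  have hs : Summable fun k => rankOne (x k) b := by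
    refine summable_of_tsum_enorm_ne_top (ne_top_of_le_ne_top
      (b := ‖b‖ₑ * ∑' k : ℕ, l1Norm (u k) ^ 2) (ENNReal.mul_ne_top (by simp) h.tsum_ne_top) ?_)
    rw [← ENNReal.tsum_mul_left]
    refine ENNReal.tsum_le_tsum fun k => ?_
    rw [hu]
    exact enorm_rankOne_le _ _
  suffices he : inducedAction A hA b = ∑' k, rankOne (x k) b by
    rw [he]
    exact hs.hasSum.tendsto_sum_nat
  ext i
  have h1 : HasSum (fun j => b j * A (delta 𝕜 j) i) (inducedAction A hA b i) :=
    (summable_norm_action A hA b).of_norm.hasSum.mapL (lp.evalCLM 𝕜 (fun _ : ℕ => 𝕜) 1 i)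
  have h2 : HasSum (fun k => (∑' j : ℕ, b j * starRingEnd 𝕜 (x k j)) * x k i)
      ((∑' k, rankOne (x k) b : ell 𝕜 1) i) :=
    hs.hasSum.mapL (lp.evalCLM 𝕜 (fun _ : ℕ => 𝕜) 1 i)
  have h3 : Summable (Function.uncurry fun j k : ℕ => b j * starRingEnd 𝕜 (x k j) * x k i) := by
    refine summable_of_tsum_enorm_ne_top (ne_top_of_le_ne_top
      (b := ‖b‖ₑ * ∑' k : ℕ, l1Norm (u k) ^ 2) (ENNReal.mul_ne_top (by simp) h.tsum_ne_top) ?_)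
    rw [ENNReal.tsum_prod', ENNReal.tsum_comm, ← ENNReal.tsum_mul_left]
    refine ENNReal.tsum_le_tsum fun k => ?_
    simp only [Function.uncurry_apply_pair, enorm_mul, RCLike.enorm_conj, ENNReal.tsum_mul_right]
    rw [_root_.sq, ← mul_assoc, hu]
    refine mul_le_mul' (tsum_enorm_mul_le b (x k)) ?_
    rw [enorm_ell_one]
    exact ENNReal.le_tsum i
  rw [← h1.tsum_eq, ← h2.tsum_eq]
  calc ∑' j, b j * A (delta 𝕜 j) i = ∑' j, ∑' k, b j * starRingEnd 𝕜 (x k j) * x k i := by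
        refine tsum_congr fun j => ?_
        rw [← (hasSum_rankOne_entry h.hasSum i j).tsum_eq, ← tsum_mul_left]
        simp only [hx, mul_assoc]
    _ = ∑' k, ∑' j, b j * starRingEnd 𝕜 (x k j) * x k i := h3.tsum_comm.symm
    _ = _ := by simp only [tsum_mul_right]

end IsL1Rep

/-! ### Passage between Γ₊ and representations; closure properties -/

theorem memℓp_one_of_l1Norm {u : ell 𝕜 2} (hu : l1Norm u ≠ ∞) : Memℓp (fun i : ℕ => u i) 1 := by
  refine memℓp_gen ?_
  simpa using tsum_enorm_ne_top_iff_summable_norm.1 hu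

theorem memℓp_two (x : ell 𝕜 1) : Memℓp (fun i : ℕ => x i) 2 :=
  (lp.memℓp x).of_exponent_ge (by norm_num)

theorem mem_gamPlus_iff {A : ell 𝕜 2 →L[𝕜] ell 𝕜 2} :
    A ∈ GamPlus 𝕜 ↔ ∃ u, IsL1Rep A u := by
  constructor
  · rintro ⟨hA, h⟩
    simp only [gammaPlus, iInf_lt_iff] at h
    obtain ⟨x, hx, hfin⟩ := h
    let u : ℕ → ell 𝕜 2 := fun k => ⟨fun i => x k i, memℓp_two (x k)⟩
    have hu : ∑' k : ℕ, l1Norm (u k) ^ 2 ≠ ∞ := by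
      simp only [l1Norm, u]
      simpa only [enorm_ell_one] using hfin.ne
    refine ⟨u, isL1Rep_of_entry hu fun i j => ?_⟩
    have hs : Summable fun k : ℕ => starRingEnd 𝕜 (u k j) * u k i :=
      (hasSum_rankOne_entry (summable_rankOne_of_l1Norm hu).hasSum i j).summable
    -- Testing strong convergence on the j-th unit vector of c₀ recovers the j-th column of A.
    let b : cZero 𝕜 := ⟨⟨Pi.single j 1, continuous_of_discreteTopology⟩, by
      rw [Filter.cocompact_eq_cofinite]
      refine tendsto_nhds_of_eventually_eq ?_
      refine Filter.mem_of_superset (Set.finite_singleton j).compl_mem_cofinite fun l hl => ?_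
      exact Pi.single_eq_of_ne hl _⟩
    have hb : ∀ l, b l = if l = j then 1 else 0 := fun l => Pi.single_apply j (1 : 𝕜) l
    have h1 : inducedAction A hA.2 b i = A (delta 𝕜 j) i := by
      rw [inducedAction_apply, tsum_eq_single j fun l hl => by simp [hb, hl]]
      simp [hb, col]
    have h2 : ∀ k, rankOne (x k) b i = starRingEnd 𝕜 (u k j) * u k i := fun k => by
      rw [rankOne, tsum_eq_single j fun l hl => by simp [hb, hl]]
      simp [hb, u]
    have h3 := ((lp.evalCLM 𝕜 (fun _ : ℕ => 𝕜) 1 i).continuous.tendsto _).comp (hx b)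
    have h4 : Filter.Tendsto (fun N : ℕ => ∑ k ∈ Finset.range N, starRingEnd 𝕜 (u k j) * u k i)
        Filter.atTop (nhds (A (delta 𝕜 j) i)) := by
      rw [← h1]
      refine h3.congr fun N => ?_
      rw [Function.comp_apply, map_sum]
      exact Finset.sum_congr rfl fun k _ => h2 k
    -- Strong convergence only concerns initial segments; since the series is already summable, its
    -- unconditional sum is the same limit.
    rw [tendsto_nhds_unique h4 hs.hasSum.tendsto_sum_nat]
    exact hs.hasSum
  · rintro ⟨u, hu⟩
    have hfin : ∀ k, l1Norm (u k) ≠ ∞ := fun k hk =>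
      ENNReal.ne_top_of_tsum_ne_top hu.tsum_ne_top k (by simp [hk])
    refine ⟨hu.mem_gam, lt_of_le_of_lt (iInf₂_le (fun k => ⟨fun i => u k i,
      memℓp_one_of_l1Norm (hfin k)⟩) (hu.isDecomposition _ fun _ _ => rfl)) ?_⟩
    simp only [enorm_ell_one]
    exact hu.tsum_ne_top.lt_top

theorem pow_mem_gamPlus {A : ell 𝕜 2 →L[𝕜] ell 𝕜 2} (hA : A ∈ GamPlus 𝕜) (n : ℕ) :
    A ^ (n + 1) ∈ GamPlus 𝕜 := by
  induction n using Nat.twoStepInduction with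
  | zero => simpa using hA
  | one => exact mem_gamPlus_iff.2 ⟨_, IsL1Rep.sq hA.1⟩
  | more n ih _ =>
    obtain ⟨u, hu⟩ := mem_gamPlus_iff.1 ih
    have h := mem_gamPlus_iff.2 ⟨_, hu.conj hA.1⟩
    rwa [← pow_succ', ← pow_succ] at h

theorem sum_mem_gamPlus {ι : Type*} (s : Finset ι) {T : ι → ell 𝕜 2 →L[𝕜] ell 𝕜 2}
    (hT : ∀ i ∈ s, T i ∈ GamPlus 𝕜) : ∑ i ∈ s, T i ∈ GamPlus 𝕜 := by
  refine Finset.sum_induction T (· ∈ GamPlus 𝕜) (fun S R hS hR => ?_)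
    (mem_gamPlus_iff.2 ⟨_, IsL1Rep.zero⟩) hT
  obtain ⟨u, hu⟩ := mem_gamPlus_iff.1 hS
  obtain ⟨v, hv⟩ := mem_gamPlus_iff.1 hR
  exact mem_gamPlus_iff.2 (hu.add hv)

end Feichtinger

theorem mainTheorem7 {𝕜 : Type*} [RCLike 𝕜]
    (A : Feichtinger.ell 𝕜 2 →L[𝕜] Feichtinger.ell 𝕜 2) :
    (A ∈ Feichtinger.GamPlus 𝕜 →
      ∀ p : Polynomial ℝ, (∀ i : ℕ, 0 ≤ p.coeff i) → p.coeff 0 = 0 →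
        Polynomial.aeval A (p.map (algebraMap ℝ 𝕜)) ∈ Feichtinger.GamPlus 𝕜) ∧
    (A ∈ Feichtinger.Gam 𝕜 → A ^ 2 ∈ Feichtinger.GamPlus 𝕜) := by
  refine ⟨fun hA p hp hp0 => ?_, fun hA =>
    Feichtinger.mem_gamPlus_iff.2 ⟨_, Feichtinger.IsL1Rep.sq hA⟩⟩
  rw [Polynomial.aeval_eq_sum_range]
  refine Feichtinger.sum_mem_gamPlus _ fun i _ => ?_
  rw [Polynomial.coeff_map]
  rcases i with _ | n
  -- The constant term must vanish: the identity has infinite ‖·‖_{1,1}.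
  · rw [hp0, map_zero, zero_smul]
    exact Feichtinger.mem_gamPlus_iff.2 ⟨_, Feichtinger.IsL1Rep.zero⟩
  · obtain ⟨u, hu⟩ := Feichtinger.mem_gamPlus_iff.1 (Feichtinger.pow_mem_gamPlus hA n)
    exact Feichtinger.mem_gamPlus_iff.2 ⟨_, hu.smul (hp (n + 1))⟩
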